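/- Fix $q\in\mathbb{Z}_{\ge 0}$. A set $\mathcal{B}\subseteq(\mathbb{R}^q)^{\mathbb{Z}}$ is called an affine behavior if it is nonempty; time-invariant ($w\in\mathcal{B}$ implies $w(\cdot+\tau)\in\mathcal{B}$ for all $\tau\in\mathbb{Z}$); complete (there is $L\in\mathbb{Z}_{\ge 0}$ such that any $w\in(\mathbb{R}^q)^{\mathbb{Z}}$ which, on each interval $[t,t+L]$ with $t\in\mathbb{Z}$, coincides with some element of $\mathcal{B}$ (possibly depending on $t$) belongs to $\mathcal{B}$); and affine ($\alpha w_1+(1-\alpha)w_2\in\mathcal{B}$ for all $w_1,w_2\in\mathcal{B}$, $\alpha\in\mathbb{R}$). It is called contractive if $\lim_{t\to\infty}(w_1(t)-w_2(t))=0$ for all $w_1,w_2\in\mathcal{B}$. Let $\sigma$ denote the shift, $(\sigma w)(t)=w(t+1)$. Let $\mathcal{B}\subseteq(\mathbb{R}^q)^{\mathbb{Z}}$ be an affine behavior. Then the following are equivalent: (i) $\mathcal{B}$ is contractive; (ii) $\mathcal{B}$ admits an offset kernel representation $\mathcal{B}=\ker_c R(\sigma):=\{w\in(\mathbb{R}^q)^{\mathbb{Z}}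 : R(\sigma)w=c\}$, where $c\in\mathbb{R}^q$ (regarded as a constant trajectory) and $R\in\mathbb{R}^{q\times q}[\xi]$ is Schur, that is, every $\lambda\in\mathbb{C}$ with $\det R(\lambda)=0$ satisfies $|\lambda|<1$ (in particular, $\det R\neq 0$); (iii) $\mathcal{B}$ admits an affine state-space representation with a Schur matrix, that is, there are $n\in\mathbb{Z}_{\ge 0}$, $A\in\mathbb{R}^{n\times n}$, $C\in\mathbb{R}^{q\times n}$, $E\in\mathbb{R}^n$ and $F\in\mathbb{R}^q$ such that every eigenvalue $\lambda\in\mathbb{C}$ of $A$ satisfies $|\lambda|<1$, and $\mathcal{B}$ is the set of all $y\in(\mathbb{R}^q)^{\mathbb{Z}}$ for which there is an $x\in(\mathbb{R}^n)^{\mathbb{Z}}$ with $x(t+1)=Ax(t)+E$ and $y(t)=Cx(t)+F$ for all $t\in\mathbb{Z}$. -/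

import Mathlib

open Filter Topology Polynomial

namespace AffineBehavior

/-- Trajectories: all maps `w : ℤ → ℝ^q`. -/
abbrev Traj (q : ℕ) : Type := ℤ → Fin q → ℝ

/-- The shift `σ^τ`, given by `(σ^τ w)(t) = w(t + τ)`. -/
def shift {q : ℕ} (τ : ℤ) (w : Traj q) : Traj q := fun t => w (t + τ)

/-- The set `B_[t₀, t₁]` of restrictions to the interval `[t₀, t₁]` of the trajectories in `B`. -/
def restriction {q : ℕ} (B : Set (Traj q)) (t₀ t₁ : ℤ) : Set (Set.Icc t₀ t₁ → Fin q → ℝ) :=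
  (fun w => (Set.Icc t₀ t₁).domRestrict w) '' B

/-- Time-invariance: `w ∈ B` implies `σ^τ w ∈ B` for all `τ ∈ ℤ`. -/
def IsTimeInvariant {q : ℕ} (B : Set (Traj q)) : Prop :=
  ∀ w ∈ B, ∀ τ : ℤ, shift τ w ∈ B

/-- Completeness: for some `L ≥ 0`, a trajectory all of whose restrictions to intervals
`[t, t + L]` are restrictions of trajectories in `B` belongs to `B`. -/
def IsComplete {q : ℕ} (B : Set (Traj q)) : Prop :=
  ∃ L : ℕ, ∀ w : Traj q,
    (∀ t : ℤ, (Set.Icc t (t + L)).domRestrict w ∈ restriction B t (t + L)) → w ∈ B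

/-- The model class `𝒜^q`: nonempty, time-invariant, complete and affine behaviors. -/
structure IsAffineBehavior {q : ℕ} (B : Set (Traj q)) : Prop where
  nonempty : B.Nonempty
  timeInvariant : IsTimeInvariant B
  complete : IsComplete B
  affine : ∀ w₁ ∈ B, ∀ w₂ ∈ B, ∀ α : ℝ, α • w₁ + (1 - α) • w₂ ∈ B

/-- Contractivity: `w₁(t) - w₂(t) → 0` as `t → ∞`, for all `w₁, w₂ ∈ B`. -/
def IsContractive {q : ℕ} (B : Set (Traj q)) : Prop :=
  ∀ w₁ ∈ B, ∀ w₂ ∈ B, Tendsto (fun t : ℤ => w₁ t - w₂ t) atTop (𝓝 0)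

/-- The shift `σ` as a linear operator on scalar trajectories, `(σ f)(t) = f(t + 1)`. -/
def scalarShift : Module.End ℝ (ℤ → ℝ) where
  toFun f := fun t => f (t + 1)
  map_add' _ _ := rfl
  map_smul' _ _ := rfl

/-- `R(σ) w` for a `p × q` polynomial matrix `R`: the `i`-th component is
`∑ j, R i j (σ) w_j`. -/
noncomputable def polyShift {p q : ℕ} (R : Matrix (Fin p) (Fin q) ℝ[X]) (w : Traj q) : Traj p :=
  fun t i => ∑ j, aeval scalarShift (R i j) (fun s => w s j) t

/-- `ker_c R(σ) = {w | R(σ) w = c}`, the vector `c` being identified with a constant trajectory. -/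
def offsetKernel {p q : ℕ} (R : Matrix (Fin p) (Fin q) ℝ[X]) (c : Fin p → ℝ) : Set (Traj q) :=
  {w | polyShift R w = fun _ => c}

/-- A square polynomial matrix is Schur if all complex roots of its determinant lie in the
open unit disk. The zero polynomial vanishes everywhere, so this forces `det R ≠ 0`. -/
def IsSchurPoly {q : ℕ} (R : Matrix (Fin q) (Fin q) ℝ[X]) : Prop :=
  ∀ z : ℂ, aeval z R.det = 0 → ‖z‖ < 1

/-- A real square matrix is Schur if all its complex eigenvalues lie in the open unit disk. -/
def IsSchurMatrix {n : ℕ} (A : Matrix (Fin n) (Fin n) ℝ) : Prop :=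
  ∀ z : ℂ, Module.End.HasEigenvalue (Matrix.toLin' (A.map (algebraMap ℝ ℂ))) z → ‖z‖ < 1

/-- The behavior of the affine state-space system with matrices `(A, C, E, F)`: all `y` such that
`x(t + 1) = A x(t) + E` and `y(t) = C x(t) + F` for all `t ∈ ℤ`, for some `x : ℤ → ℝ^n`. -/
def stateSpaceBehavior {n q : ℕ} (A : Matrix (Fin n) (Fin n) ℝ) (C : Matrix (Fin q) (Fin n) ℝ)
    (E : Fin n → ℝ) (F : Fin q → ℝ) : Set (Traj q) :=
  {y | ∃ x : Traj n, ∀ t : ℤ, x (t + 1) = A.mulVec (x t) + E ∧ y t = C.mulVec (x t) + F}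

end AffineBehavior

namespace AffineBehavior

/-! Representations imply contractivity because differences of trajectories solve homogeneous
recursions. Their coordinates (those of the state in the state-space case) are annihilated by `det
R`, through the adjugate, or by the characteristic polynomial of `A`, through Cayley-Hamilton. A
sequence annihilated by `p(σ)` with all roots of `p` in the open disk tends to zero.

Conversely, a contractive `B` is `b + V` with `V` linear, shift-invariant, complete and made of null
trajectories. Such a `V` has no free inputs: a trajectory starting from rest could be convolved into
a non-null one. Hence finitely many samples determine a trajectory (`window_injective`) and `V` is
finite-dimensional. Since `1` is not an eigenvalue of `σ` on `V`, `σ - 1` is invertible there and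
`b` can be replaced by a constant (`exists_eq_const_add`). Duality makes `V` the kernel of its
module of annihilating rows, which is free of rank at most `q` (`exists_kernel`); taking `V` as
state space with `σ` as dynamics gives `exists_stateSpace`. A nonzero root of `det R`, or an
eigenvalue of `A`, produces a geometric trajectory in the complexification of `V`, so it has modulus
below one. -/

/-! ### Stability of scalar difference equations. -/

/-- The shift on complex scalar trajectories. -/
def complexShift : Module.End ℂ (ℤ → ℂ) where
  toFun f := fun t => f (t + 1)
  map_add' _ _ := rfl
  map_smul' _ _ := rfl

theorem aeval_scalarShift_apply (p : ℝ[X]) (f : ℤ → ℝ) (t : ℤ) :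
    aeval scalarShift p f t = p.sum fun k a => a * f (t + k) := by
  have pow : ∀ (n : ℕ) (g : ℤ → ℝ) (s : ℤ), (scalarShift ^ n) g s = g (s + n) := by
    intro n
    induction n with
    | zero => intro g s; simp
    | succ n ih =>
      intro g s
      rw [pow_succ, Module.End.mul_apply, ih]
      change g (s + n + 1) = _
      congr 1; push_cast; ring
  rw [aeval_eq_sum_range, Polynomial.sum_over_range _ (by simp)]
  simp [LinearMap.sum_apply, Finset.sum_apply, pow]

theorem aeval_complexShift_apply (p : ℂ[X]) (f : ℤ → ℂ) (t : ℤ) :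
    aeval complexShift p f t = p.sum fun k a => a * f (t + k) := by
  have pow : ∀ (n : ℕ) (g : ℤ → ℂ) (s : ℤ), (complexShift ^ n) g s = g (s + n) := by
    intro n
    induction n with
    | zero => intro g s; simp
    | succ n ih =>
      intro g s
      rw [pow_succ, Module.End.mul_apply, ih]
      change g (s + n + 1) = _
      congr 1; push_cast; ring
  rw [aeval_eq_sum_range, Polynomial.sum_over_range _ (by simp)]
  simp [LinearMap.sum_apply, Finset.sum_apply, pow]

theorem aeval_complexShift_map (p : ℝ[X]) (f : ℤ → ℝ) (t : ℤ) :
    aeval complexShift (p.map (algebraMap ℝ ℂ)) (fun s => (f s : ℂ)) t =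
      (aeval scalarShift p f t : ℝ) := by
  rw [aeval_complexShift_apply, aeval_scalarShift_apply, Polynomial.sum_over_range _ (by simp),
    Polynomial.sum_over_range _ (by simp), Polynomial.natDegree_map]
  simp

/-- A stable first-order linear recursion driven by a null sequence tends to zero. -/
theorem tendsto_zero_of_first_order {a : ℂ} (ha : ‖a‖ < 1) {g h : ℤ → ℂ}
    (hg : ∀ t, g (t + 1) = a * g t + h t) (hh : Tendsto h atTop (𝓝 0)) :
    Tendsto g atTop (𝓝 0) := by
  rw [Metric.tendsto_atTop]
  intro ε hε
  rw [Metric.tendsto_atTop] at hh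
  -- With this bound on `h`, the value `ε / 2` is a fixed point of the norm recursion `e ↦ ‖a‖ * e +
  -- bound`.
  obtain ⟨T, hT⟩ := hh (ε / 2 * (1 - ‖a‖)) (mul_pos (by linarith) (by linarith))
  have key : ∀ n : ℕ, ‖g (T + n)‖ ≤ ‖a‖ ^ n * ‖g T‖ + ε / 2 := by
    intro n
    induction n with
    | zero => simp; linarith
    | succ n ih =>
      have h1 : ‖h (T + n)‖ < ε / 2 * (1 - ‖a‖) := by simpa using hT (T + n) (by omega)
      have h2 : g (T + (n + 1 : ℕ)) = a * g (T + n) + h (T + n) := by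
        rw [← hg]; congr 1; push_cast; ring
      rw [h2]
      have h3 := norm_add_le (a * g (T + n)) (h (T + n))
      rw [norm_mul] at h3
      have h4 := mul_le_mul_of_nonneg_left ih (norm_nonneg a)
      rw [pow_succ]
      linarith
  have hpow : Tendsto (fun n : ℕ => ‖a‖ ^ n * ‖g T‖) atTop (𝓝 0) := by
    simpa using (tendsto_pow_atTop_nhds_zero_of_lt_one (norm_nonneg a) ha).mul_const ‖g T‖
  obtain ⟨N, hN⟩ := (hpow.eventually (gt_mem_nhds (half_pos hε))).exists_forall_of_atTop
  refine ⟨T + N, fun t ht => ?_⟩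
  have h1 := key (t - T).toNat
  have h2 := hN (t - T).toNat (by omega)
  rw [Int.toNat_of_nonneg (by omega), add_sub_cancel] at h1
  rw [dist_zero_right]
  linarith

/-- Linear factors are peeled off one at a time. The hypothesis is a null limit rather than
annihilation because `(σ - a) f` is only known to be null after a peeling. -/
theorem tendsto_zero_of_aeval_prod (s : Multiset ℂ) (hs : ∀ z ∈ s, ‖z‖ < 1) (f : ℤ → ℂ)
    (hf : Tendsto (aeval complexShift (s.map fun z => X - C z).prod f) atTop (𝓝 0)) :
    Tendsto f atTop (𝓝 0) := by
  induction s using Multiset.induction_on generalizing f with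
  | empty => simpa using hf
  | cons a s ih =>
    rw [Multiset.map_cons, Multiset.prod_cons, mul_comm, map_mul, Module.End.mul_apply] at hf
    have h1 := ih (fun z hz => hs z (Multiset.mem_cons_of_mem hz)) _ hf
    refine tendsto_zero_of_first_order (hs a (Multiset.mem_cons_self a s)) (fun t => ?_) h1
    have : aeval complexShift (X - C a) f t = f (t + 1) - a * f t := by
      simp [complexShift]
    rw [this]; ring

/-- A real trajectory annihilated by a polynomial in the shift with all its complex roots in the
open unit disk tends to zero. -/
theorem tendsto_zero_of_aeval_eq_zero {p : ℝ[X]} (hp : ∀ z : ℂ, aeval z p = 0 → ‖z‖ < 1)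
    {f : ℤ → ℝ} (hf : aeval scalarShift p f = 0) : Tendsto f atTop (𝓝 0) := by
  have hp0 : p ≠ 0 := by
    rintro rfl
    simpa using hp 1 (by simp)
  set P := p.map (algebraMap ℝ ℂ) with hP
  have hP0 : P ≠ 0 := (Polynomial.map_ne_zero_iff (algebraMap ℝ ℂ).injective).2 hp0
  have hroots : ∀ z ∈ P.roots, ‖z‖ < 1 := fun z hz => hp z (by
    rw [mem_roots hP0, IsRoot.def, hP, eval_map_algebraMap] at hz
    exact hz)
  have hfac := (IsAlgClosed.splits P).eq_prod_roots
  have hz : aeval complexShift P (fun s => (f s : ℂ)) = 0 := by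
    funext t
    rw [hP, aeval_complexShift_map, hf]; simp
  rw [hfac, map_mul, aeval_C, Module.End.mul_apply, Module.algebraMap_end_apply,
    smul_eq_zero] at hz
  have hz' := hz.resolve_left (leadingCoeff_ne_zero.2 hP0)
  have := tendsto_zero_of_aeval_prod P.roots hroots (fun s => (f s : ℂ))
    (by rw [hz']; exact tendsto_const_nhds)
  have h2 := (Complex.continuous_re.tendsto 0).comp this
  simpa [Function.comp_def] using h2

/-! ### Polynomial matrices in the shift, and stability of Schur systems. -/

/-- The scalar operator `r(σ)` attached to a row `r` of polynomials. -/
noncomputable def rowShift {q : ℕ} : (Fin q → ℝ[X]) →ₗ[ℝ] Traj q →ₗ[ℝ] (ℤ → ℝ) :=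
  LinearMap.mk₂ ℝ (fun r w => ∑ j, aeval scalarShift (r j) (fun s => w s j))
    (fun r r' w => by simp [Finset.sum_add_distrib])
    (fun a r w => by simp [Finset.smul_sum])
    (fun r w w' => by
      rw [← Finset.sum_add_distrib]
      exact Finset.sum_congr rfl fun j _ => map_add _ (fun s => w s j) (fun s => w' s j))
    (fun a r w => by
      rw [Finset.smul_sum]
      exact Finset.sum_congr rfl fun j _ => map_smul _ a (fun s => w s j))

theorem rowShift_apply {q : ℕ} (r : Fin q → ℝ[X]) (w : Traj q) :
    rowShift r w = ∑ j, aeval scalarShift (r j) (fun s => w s j) := rfl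

theorem polyShift_apply {p q : ℕ} (R : Matrix (Fin p) (Fin q) ℝ[X]) (w : Traj q) (t : ℤ)
    (i : Fin p) : polyShift R w t i = rowShift (R i) w t := by
  simp [polyShift, rowShift_apply, Finset.sum_apply]

theorem polyShift_sub {p q : ℕ} (R : Matrix (Fin p) (Fin q) ℝ[X]) (w w' : Traj q) :
    polyShift R (w - w') = polyShift R w - polyShift R w' := by
  funext t i
  simp [polyShift_apply]

theorem rowShift_smul {q : ℕ} (p : ℝ[X]) (r : Fin q → ℝ[X]) (w : Traj q) :
    rowShift (p • r) w = aeval scalarShift p (rowShift r w) := by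
  simp [rowShift_apply, map_sum]

theorem rowShift_shift {q : ℕ} (r : Fin q → ℝ[X]) (w : Traj q) (τ t : ℤ) :
    rowShift r (shift τ w) t = rowShift r w (t + τ) := by
  simp only [rowShift_apply, Finset.sum_apply, aeval_scalarShift_apply, shift]
  refine Finset.sum_congr rfl fun j _ => Finset.sum_congr rfl fun k _ => ?_
  simp only [add_right_comm]

theorem rowShift_single {q : ℕ} (j : Fin q) (k : ℕ) (w : Traj q) (t : ℤ) :
    rowShift (Pi.single j (X ^ k)) w t = w (t + k) j := by
  rw [rowShift_apply, Finset.sum_apply, Finset.sum_eq_single j]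
  · rw [aeval_scalarShift_apply, Pi.single_eq_same, X_pow_eq_monomial,
      Polynomial.sum_monomial_index] <;> simp
  · intro i _ hi
    simp [Pi.single_eq_of_ne hi]
  · simp

/-- A Schur kernel with zero offset consists of trajectories that tend to zero. -/
theorem tendsto_zero_of_polyShift_eq_zero {q : ℕ} {R : Matrix (Fin q) (Fin q) ℝ[X]}
    (hR : IsSchurPoly R) {w : Traj q} (hw : polyShift R w = 0) : Tendsto w atTop (𝓝 0) := by
  rw [tendsto_pi_nhds]
  intro j
  refine tendsto_zero_of_aeval_eq_zero hR ?_
  have h1 : ∀ i, rowShift (R i) w = 0 := fun i => by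
    funext t
    rw [← polyShift_apply, hw]; rfl
  -- Row `j` of `adj(R) R = det(R) I`: it decouples the system, so `det R` annihilates each
  -- component.
  have h2 : ∑ i, R.adjugate j i • R i = Pi.single j R.det := by
    have := congrFun (Matrix.adjugate_mul R) j
    funext k
    rw [Finset.sum_apply]
    simpa [Matrix.mul_apply, Matrix.one_apply, Pi.single_apply, eq_comm] using congrFun this k
  have h3 : rowShift (Pi.single j R.det) w = 0 := by
    rw [← h2, map_sum, LinearMap.sum_apply]
    exact Finset.sum_eq_zero fun i _ => by rw [rowShift_smul, h1, map_zero]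
  rw [rowShift_apply, Finset.sum_eq_single j] at h3
  · simpa using h3
  · intro i _ hi
    simp [Pi.single_eq_of_ne hi]
  · simp

/-- Solutions of `x(t + 1) = A x(t)` tend to zero when `A` is Schur. -/
theorem tendsto_zero_of_isSchurMatrix {n : ℕ} {A : Matrix (Fin n) (Fin n) ℝ}
    (hA : IsSchurMatrix A) {x : Traj n} (hx : ∀ t, x (t + 1) = A.mulVec (x t)) :
    Tendsto x atTop (𝓝 0) := by
  have hp : ∀ z : ℂ, aeval z A.charpoly = 0 → ‖z‖ < 1 := by
    intro z hz
    apply hA z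
    rw [Module.End.hasEigenvalue_iff_mem_spectrum, Matrix.spectrum_toLin',
      Matrix.mem_spectrum_iff_isRoot_charpoly, Matrix.charpoly_map, IsRoot.def,
      eval_map_algebraMap]
    exact hz
  rw [tendsto_pi_nhds]
  intro j
  refine tendsto_zero_of_aeval_eq_zero hp ?_
  have hpow : ∀ (k : ℕ) (t : ℤ), x (t + k) = (A ^ k).mulVec (x t) := by
    intro k
    induction k with
    | zero => intro t; simp
    | succ k ih =>
      intro t
      rw [pow_succ', ← Matrix.mulVec_mulVec, ← ih, ← hx]
      congr 1; push_cast; ring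
  -- On solutions `p(σ)` acts as the matrix `p(A)`, so Cayley-Hamilton applies.
  have h : ∀ (p : ℝ[X]) (t : ℤ),
      aeval scalarShift p (fun s => x s j) t = (aeval A p).mulVec (x t) j := by
    intro p t
    rw [aeval_scalarShift_apply, aeval_eq_sum_range, Polynomial.sum_over_range _ (by simp),
      Matrix.sum_mulVec, Finset.sum_apply]
    simp [hpow, Matrix.smul_mulVec]
  funext t
  rw [h, Matrix.aeval_self_charpoly]
  simp


/-! ### Null behaviors: autonomy and finite dimension. -/

/-- A linear, shift-invariant, complete set of trajectories, all of which tend to zero. -/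
structure IsNullBehavior {q : ℕ} (V : Submodule ℝ (Traj q)) (L : ℕ) : Prop where
  shift_mem : ∀ v ∈ V, ∀ τ : ℤ, shift τ v ∈ V
  complete : ∀ w : Traj q,
    (∀ t : ℤ, ∃ v ∈ V, ∀ s ∈ Set.Icc t (t + L), w s = v s) → w ∈ V
  tendsto_zero : ∀ v ∈ V, Tendsto v atTop (𝓝 0)

namespace IsNullBehavior

variable {q L : ℕ} {V : Submodule ℝ (Traj q)}

/-- A trajectory vanishing at all negative times vanishes at time zero: otherwise a causal
convolution of it would be a trajectory with a component equal to `1` at all nonnegative times. -/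
theorem apply_zero_eq_zero (hV : IsNullBehavior V L) {u : Traj q} (hu : u ∈ V)
    (hneg : ∀ t < 0, u t = 0) : u 0 = 0 := by
  funext i
  by_contra hi
  change u 0 i ≠ 0 at hi
  let U : PowerSeries ℝ := PowerSeries.mk fun n => u n i
  have hU : PowerSeries.constantCoeff U ≠ 0 := by
    simpa [U, ← PowerSeries.coeff_zero_eq_constantCoeff_apply] using hi
  -- The input that turns the response `U` into `1 + X + X² + ⋯`; it exists because `u 0 i ≠ 0`
  -- makes `U` invertible.
  let a : PowerSeries ℝ := PowerSeries.mk (fun _ => (1 : ℝ)) * U⁻¹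
  have haU : a * U = PowerSeries.mk (fun _ => (1 : ℝ)) := by
    rw [mul_assoc, PowerSeries.inv_mul_cancel U hU, mul_one]
  let w : Traj q := fun t => ∑ k ∈ Finset.range (t.toNat + 1), PowerSeries.coeff k a • u (t - k)
  -- Extra terms vanish by causality, so on a whole window one finite combination of shifts of `u`
  -- computes `w`; completeness then applies.
  have hext : ∀ (t : ℤ) (N : ℕ), t < N →
      w t = ∑ k ∈ Finset.range N, PowerSeries.coeff k a • u (t - k) := by
    intro t N hN
    have hz : ∀ k : ℕ, t < k → PowerSeries.coeff k a • u (t - k) = 0 := fun k hk => by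
      rw [hneg _ (by omega), smul_zero]
    rcases le_total (t.toNat + 1) N with h | h
    · refine Finset.sum_subset (Finset.range_mono h) fun k _ hk => hz k ?_
      simp only [Finset.mem_range] at hk
      omega
    · refine (Finset.sum_subset (Finset.range_mono h) fun k _ hk => hz k ?_).symm
      simp only [Finset.mem_range] at hk
      omega
  have hw : w ∈ V := by
    refine hV.complete w fun t => ?_
    refine ⟨∑ k ∈ Finset.range ((t + L).toNat + 1), PowerSeries.coeff k a • shift (-(k : ℤ)) u,
      V.sum_mem fun k _ => V.smul_mem _ (hV.shift_mem u hu _), fun s hs => ?_⟩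
    rw [hext s ((t + L).toNat + 1) (by have := hs.2; omega)]
    simp [Finset.sum_apply, shift, sub_eq_add_neg]
  have hone : ∀ n : ℕ, w n i = 1 := by
    intro n
    have h1 : PowerSeries.coeff n (a * U) = 1 := by rw [haU]; simp
    rw [PowerSeries.coeff_mul, Finset.Nat.sum_antidiagonal_eq_sum_range_succ_mk] at h1
    rw [hext n (n + 1) (by push_cast; omega), Finset.sum_apply, ← h1]
    refine Finset.sum_congr rfl fun k hk => ?_
    have hk' : k ≤ n := Nat.lt_succ_iff.1 (Finset.mem_range.1 hk)
    simp [U, Nat.cast_sub hk']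
  have hlim := ((tendsto_pi_nhds.1 (hV.tendsto_zero w hw)) i).comp
    (tendsto_natCast_atTop_atTop (R := ℤ))
  simp [Function.comp_def, hone] at hlim

/-- A trajectory vanishing on a window of length `L` vanishes at all later times. -/
theorem eq_zero_of_nonneg (hV : IsNullBehavior V L) {v : Traj q} (hv : v ∈ V)
    (hwin : ∀ t : ℤ, 0 ≤ t → t < L → v t = 0) : ∀ t : ℤ, 0 ≤ t → v t = 0 := by
  -- Windows have `L + 1` points, so one starting before `0` ends before `L` and sees only zeros of
  -- the cut trajectory; any other window sees `v`.
  have hcut : (fun t => if 0 ≤ t then v t else 0) ∈ V := by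
    refine hV.complete _ fun t => ?_
    rcases le_or_gt 0 t with ht | ht
    · exact ⟨v, hv, fun s hs => if_pos (ht.trans hs.1)⟩
    · refine ⟨0, V.zero_mem, fun s hs => ?_⟩
      by_cases h : 0 ≤ s
      · simpa [h] using hwin s h (by have := hs.2; omega)
      · simp [h]
  suffices h : ∀ n : ℕ, v n = 0 by
    intro t ht
    lift t to ℕ using ht
    exact h t
  intro n
  induction n using Nat.strong_induction_on with
  | _ n ih =>
    have := hV.apply_zero_eq_zero (hV.shift_mem _ hcut n) (fun t ht => by
      by_cases h : 0 ≤ t + n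
      · lift t + n to ℕ using h with m hm
        simpa [shift, ← hm] using ih m (by omega)
      · simp [shift, h])
    simpa [shift] using this

/-- The shift restricted to `V`. -/
def shiftEnd (hV : IsNullBehavior V L) : Module.End ℝ V where
  toFun v := ⟨shift 1 v, hV.shift_mem v v.2 1⟩
  map_add' _ _ := rfl
  map_smul' _ _ := rfl

theorem shiftEnd_apply (hV : IsNullBehavior V L) (v : V) (t : ℤ) :
    (hV.shiftEnd v : Traj q) t = (v : Traj q) (t + 1) := rfl

theorem shiftEnd_surjective (hV : IsNullBehavior V L) : Function.Surjective hV.shiftEnd := by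
  intro v
  refine ⟨⟨shift (-1) v, hV.shift_mem v v.2 _⟩, Subtype.ext (funext fun t => ?_)⟩
  simp [shiftEnd_apply, shift]

/-- The restriction of trajectories to the window `[0, L)`. -/
def window (V : Submodule ℝ (Traj q)) (L : ℕ) : V →ₗ[ℝ] (Fin L → Fin q → ℝ) where
  toFun v k := (v : Traj q) (k : ℕ)
  map_add' _ _ := rfl
  map_smul' _ _ := rfl

theorem mem_ker_window (hV : IsNullBehavior V L) (v : V) :
    v ∈ LinearMap.ker (window V L) ↔ ∀ t : ℤ, 0 ≤ t → (v : Traj q) t = 0 := by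
  refine ⟨fun h => hV.eq_zero_of_nonneg v.2 fun t h0 hL => ?_, fun h => ?_⟩
  · lift t to ℕ using h0
    exact congrFun (LinearMap.mem_ker.1 h) ⟨t, by omega⟩
  · exact LinearMap.mem_ker.2 (funext fun k => h _ (by positivity))

/-- A trajectory vanishing on the window `[0, L)` is zero. -/
theorem window_injective (hV : IsNullBehavior V L) : Function.Injective (window V L) := by
  set K := LinearMap.ker (window V L) with hK
  have hKT : K ≤ K.comap hV.shiftEnd := fun v hv => by
    rw [hK, hV.mem_ker_window] at hv
    rw [Submodule.mem_comap, hK, hV.mem_ker_window]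
    exact fun t ht => hv (t + 1) (by omega)
  -- `K` consists of the trajectories vanishing at nonnegative times. The shift is surjective on the
  -- finite-dimensional quotient, hence injective there, so zeros propagate backwards in time.
  have : FiniteDimensional ℝ (V ⧸ K) :=
    Module.Finite.equiv (window V L).quotKerEquivRange.symm
  have hsurj : Function.Surjective (K.mapQ K hV.shiftEnd hKT) := by
    intro x
    obtain ⟨v, rfl⟩ := K.mkQ_surjective x
    obtain ⟨u, rfl⟩ := hV.shiftEnd_surjective v
    exact ⟨K.mkQ u, rfl⟩
  have hinj := LinearMap.injective_iff_surjective.2 hsurj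
  have hback : ∀ v : V, hV.shiftEnd v ∈ K → v ∈ K := fun v hv => by
    rw [← Submodule.Quotient.mk_eq_zero K]
    refine hinj ?_
    rw [map_zero, Submodule.mapQ_apply, Submodule.Quotient.mk_eq_zero]
    exact hv
  have hneg : ∀ (n : ℕ) (v : V), v ∈ K → ∀ t : ℤ, -n ≤ t → (v : Traj q) t = 0 := by
    intro n
    induction n with
    | zero => intro v hv t ht; exact (hV.mem_ker_window v).1 hv t (by simpa using ht)
    | succ n ih =>
      intro v hv t ht
      obtain ⟨u, rfl⟩ := hV.shiftEnd_surjective v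
      rw [shiftEnd_apply]
      exact ih u (hback u hv) _ (by push_cast at ht; omega)
  rw [← LinearMap.ker_eq_bot, Submodule.eq_bot_iff]
  exact fun v hv => Subtype.ext (funext fun t => hneg t.natAbs v hv t (by omega))

theorem finiteDimensional (hV : IsNullBehavior V L) : FiniteDimensional ℝ V :=
  Module.Finite.of_injective (window V L) hV.window_injective

/-- A trajectory vanishing on a right half-line is zero. -/
theorem eq_zero_of_forall_ge (hV : IsNullBehavior V L) {v : Traj q} (hv : v ∈ V) (a : ℤ)
    (h : ∀ t, a ≤ t → v t = 0) : v = 0 := by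
  have h1 : (⟨shift a v, hV.shift_mem v hv a⟩ : V) = 0 := hV.window_injective (by
    rw [map_zero]
    exact funext fun k => h _ (by omega))
  funext t
  have h2 := congrFun (congrArg Subtype.val h1) (t - a)
  simpa [shift] using h2

theorem eq_zero_of_shift_one_eq (hV : IsNullBehavior V L) {v : Traj q} (hv : v ∈ V)
    (h : ∀ t, v (t + 1) = v t) : v = 0 := by
  have hconst : ∀ t, v t = v 0 := fun t => by
    induction t using Int.induction_on with
    | zero => rfl
    | succ k ih => rw [h, ih]
    | pred k ih => rw [← ih, ← h (-(k : ℤ) - 1), sub_add_cancel]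
  have hlim := hV.tendsto_zero v hv
  have heq : v = fun _ => v 0 := funext hconst
  rw [heq] at hlim
  rw [heq, tendsto_nhds_unique tendsto_const_nhds hlim]
  rfl

/-- Every `v ∈ V` is of the form `σ u - u` with `u ∈ V`. -/
theorem exists_shift_sub (hV : IsNullBehavior V L) {v : Traj q} (hv : v ∈ V) :
    ∃ u ∈ V, ∀ t, u (t + 1) - u t = v t := by
  have := hV.finiteDimensional
  have hinj : Function.Injective (hV.shiftEnd - 1 : Module.End ℝ V) := by
    rw [← LinearMap.ker_eq_bot, Submodule.eq_bot_iff]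
    intro u hu
    refine Subtype.ext (hV.eq_zero_of_shift_one_eq u.2 fun t => ?_)
    exact sub_eq_zero.1 (congrFun (congrArg Subtype.val (LinearMap.mem_ker.1 hu)) t)
  obtain ⟨u, hu⟩ := LinearMap.injective_iff_surjective.1 hinj ⟨v, hv⟩
  exact ⟨u, u.2, fun t => congrFun (congrArg Subtype.val hu) t⟩

/-- If the real and imaginary parts of a nonzero complex geometric trajectory belong to `V`, then
its ratio lies in the open unit disk. -/
theorem norm_lt_one_of_geometric (hV : IsNullBehavior V L) {u v : Traj q} (hu : u ∈ V)
    (hv : v ∈ V) {z : ℂ} {s : ℤ} {j : Fin q} (hs : (u s j : ℂ) + v s j * Complex.I ≠ 0)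
    (h : ∀ t i, (u (t + 1) i : ℂ) + v (t + 1) i * Complex.I =
      z * (u t i + v t i * Complex.I)) : ‖z‖ < 1 := by
  set g : ℤ → ℂ := fun t => (u t j : ℂ) + v t j * Complex.I with hg
  have hgn : ∀ n : ℕ, g (s + n) = z ^ n * g s := by
    intro n
    induction n with
    | zero => simp
    | succ n ih =>
      have := h (s + n) j
      rw [pow_succ', mul_assoc, ← ih, ← this]
      simp only [hg]
      push_cast
      simp only [add_assoc]
  have hc : ∀ w ∈ V, Tendsto (fun t => ((w t j : ℝ) : ℂ)) atTop (𝓝 0) := fun w hw => by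
    have := (Complex.continuous_ofReal.tendsto 0).comp
      ((tendsto_pi_nhds.1 (hV.tendsto_zero w hw)) j)
    simpa [Function.comp_def] using this
  have hglim : Tendsto g atTop (𝓝 0) := by
    simpa using (hc u hu).add ((hc v hv).mul_const Complex.I)
  have hshift : Tendsto (fun n : ℕ => s + (n : ℤ)) atTop atTop :=
    tendsto_atTop_add_const_left _ _ tendsto_natCast_atTop_atTop
  have h1 : Tendsto (fun n : ℕ => z ^ n * g s) atTop (𝓝 0) := by
    simpa [Function.comp_def, hgn] using hglim.comp hshift
  have h2 : Tendsto (fun n : ℕ => z ^ n) atTop (𝓝 0) := by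
    have := h1.mul_const (g s)⁻¹
    simpa [mul_assoc, mul_inv_cancel₀ (show g s ≠ 0 from hs)] using this
  exact tendsto_pow_atTop_nhds_zero_iff_norm_lt_one.1 h2

/-! ### Kernel and state-space representations of null behaviors. -/

/-- The module of polynomial rows annihilating `V`. -/
def annihilator (V : Submodule ℝ (Traj q)) : Submodule ℝ[X] (Fin q → ℝ[X]) where
  carrier := {r | ∀ v ∈ V, rowShift r v = 0}
  add_mem' hr hr' v hv := by rw [map_add, LinearMap.add_apply, hr v hv, hr' v hv, add_zero]
  zero_mem' v _ := by rw [map_zero, LinearMap.zero_apply]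
  smul_mem' p r hr v hv := by rw [rowShift_smul, hr v hv, map_zero]

/-- A trajectory annihilated by all the rows annihilating `V` belongs to `V`. -/
theorem mem_of_annihilator (hV : IsNullBehavior V L) {w : Traj q}
    (hw : ∀ r ∈ annihilator V, rowShift r w = 0) : w ∈ V := by
  have := hV.finiteDimensional
  let b := Module.finBasis ℝ V
  let ev (t : ℤ) (v : Traj q) : (Fin q → ℝ[X]) →ₗ[ℝ] ℝ := (LinearMap.proj t).comp (rowShift.flip v)
  have hev : ∀ t v r, ev t v r = rowShift r v t := fun _ _ _ => rfl
  -- on each right half-line `w` agrees with an element of `V`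
  have hhalf : ∀ a : ℤ, ∃ v ∈ V, ∀ t, a ≤ t → w t = v t := by
    intro a
    -- Finite-dimensional duality. A row killed by the basis functionals at the single time `a`
    -- annihilates `V`, by shift-invariance, and therefore `w`.
    have hmem : ev a w ∈ Submodule.span ℝ (Set.range fun i => ev a (b i)) := by
      apply mem_span_of_iInf_ker_le_ker
      intro r hr
      have hr' : ∀ v : V, rowShift r v a = 0 := by
        intro v
        have hsum := congrArg Subtype.val (b.sum_repr v)
        have hbi : ∀ i, rowShift r (b i) a = 0 := fun i =>
          (Submodule.mem_iInf _).1 hr i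
        rw [AddSubmonoidClass.coe_finsetSum] at hsum
        rw [← hsum, map_sum, Finset.sum_apply]
        simp [hbi]
      have hrV : r ∈ annihilator V := fun v hv => by
        funext t
        have := hr' ⟨shift (t - a) v, hV.shift_mem v hv _⟩
        simpa [rowShift_shift] using this
      rw [LinearMap.mem_ker, hev, hw r hrV]
      rfl
    obtain ⟨c, hc⟩ := (Submodule.mem_span_range_iff_exists_fun ℝ).1 hmem
    refine ⟨(∑ i, c i • b i : V), Submodule.coe_mem _, fun t ht => ?_⟩
    funext j
    -- The rows `X ^ k` in position `j` sample `w` at time `a + k`; with `k ≥ 0` only times from `a`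
    -- on are reached.
    have h1 := LinearMap.congr_fun hc (Pi.single j (X ^ (t - a).toNat))
    have h2 : a + ((t - a).toNat : ℤ) = t := by omega
    simp only [LinearMap.sum_apply, LinearMap.smul_apply, hev, rowShift_single, h2] at h1
    rw [← h1]
    simp [Finset.sum_apply]
  obtain ⟨v, hv, hwv⟩ := hhalf 0
  convert hv
  funext t
  obtain ⟨u, hu, hwu⟩ := hhalf (min t 0)
  have huv := hV.eq_zero_of_forall_ge (V.sub_mem hu hv) 0 fun s hs => by
    rw [Pi.sub_apply, ← hwu s ((min_le_right _ _).trans hs), ← hwv s hs, sub_self]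
  rw [hwu t (min_le_left _ _), sub_eq_zero.1 huv]

theorem exists_kernel (hV : IsNullBehavior V L) :
    ∃ R : Matrix (Fin q) (Fin q) ℝ[X], ∀ w, polyShift R w = 0 ↔ w ∈ V := by
  obtain ⟨n, ⟨b⟩⟩ := (annihilator V).nonempty_basis_of_pid (Pi.basisFun ℝ[X] (Fin q))
  have hn : n ≤ q := by
    have h1 := Submodule.finrank_le (annihilator V)
    rwa [Module.finrank_eq_card_basis b, Module.finrank_fin_fun, Fintype.card_fin] at h1
  -- A basis of the annihilator, padded with zero rows to a square matrix.
  let R : Matrix (Fin q) (Fin q) ℝ[X] := fun i =>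
    if h : (i : ℕ) < n then (b ⟨i, h⟩ : Fin q → ℝ[X]) else 0
  refine ⟨R, fun w => ⟨fun hw => hV.mem_of_annihilator fun r hr => ?_, fun hw => ?_⟩⟩
  · have hb : ∀ i, rowShift (b i : Fin q → ℝ[X]) w = 0 := fun i => by
      have h1 : R (Fin.castLE hn i) = b i := by simp [R]
      funext t
      rw [← h1, ← polyShift_apply, hw]; rfl
    have hsum := congrArg Subtype.val (b.sum_repr ⟨r, hr⟩)
    rw [AddSubmonoidClass.coe_finsetSum] at hsum
    change _ = r at hsum
    rw [← hsum, map_sum, LinearMap.sum_apply]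
    simp [rowShift_smul, hb]
  · funext t i
    rw [polyShift_apply]
    by_cases h : (i : ℕ) < n
    · simp only [R, dif_pos h]
      rw [(b ⟨i, h⟩).2 w hw]; rfl
    · simp [R, dif_neg h]

/-- Complex null vectors of `R(z)`, `z ≠ 0`, give geometric trajectories in the kernel of
`R(σ)`. -/
theorem isSchurPoly_of_kernel (hV : IsNullBehavior V L) {R : Matrix (Fin q) (Fin q) ℝ[X]}
    (hR : ∀ w, polyShift R w = 0 → w ∈ V) : IsSchurPoly R := by
  intro z hz
  -- The geometric trajectory `z ^ t` needs `z ≠ 0` at negative times. The case `det R = 0` needs no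
  -- separate treatment, every `z` then being a root.
  rcases eq_or_ne z 0 with rfl | hz0
  · simp
  have hdet : (R.map (aeval z : ℝ[X] →ₐ[ℝ] ℂ)).det = 0 := by
    rw [← hz]
    exact (AlgHom.map_det (aeval z) R).symm
  obtain ⟨x, hx0, hx⟩ := Matrix.exists_mulVec_eq_zero_iff.2 hdet
  have haev : ∀ (φ : ℂ →ₗ[ℝ] ℝ) (p : ℝ[X]) (y : ℂ) (t : ℤ),
      aeval scalarShift p (fun s => φ (z ^ s * y)) t = φ (z ^ t * (aeval z p * y)) := by
    intro φ p y t
    rw [aeval_scalarShift_apply, aeval_eq_sum_range, Polynomial.sum_over_range _ (by simp),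
      Finset.sum_mul, Finset.mul_sum, map_sum]
    refine Finset.sum_congr rfl fun k _ => ?_
    rw [← smul_eq_mul, ← map_smul, zpow_add₀ hz0, zpow_natCast]
    congr 1
    simp only [Complex.real_smul]
    ring
  have hmem : ∀ φ : ℂ →ₗ[ℝ] ℝ, (fun t j => φ (z ^ t * x j) : Traj q) ∈ V := by
    intro φ
    refine hR _ (funext fun t => funext fun i => ?_)
    rw [polyShift]
    simp only [haev]
    rw [← map_sum, ← Finset.mul_sum]
    have := congrFun hx i
    simp only [Matrix.mulVec, dotProduct, Matrix.map_apply, Pi.zero_apply] at this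
    rw [this]
    simp
  obtain ⟨j, hj⟩ := Function.ne_iff.1 hx0
  refine hV.norm_lt_one_of_geometric (hmem Complex.reLm) (hmem Complex.imLm) (z := z) (s := 0)
    (j := j) ?_ fun t i => ?_
  · simpa [Complex.re_add_im] using hj
  · simp only [Complex.reLm_coe, Complex.imLm_coe, Complex.re_add_im]
    rw [zpow_add_one₀ hz0]
    ring

/-- State-space representation with the trajectories themselves as states. -/
theorem exists_stateSpace (hV : IsNullBehavior V L) :
    ∃ (n : ℕ) (A : Matrix (Fin n) (Fin n) ℝ) (C : Matrix (Fin q) (Fin n) ℝ), IsSchurMatrix A ∧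
      ∀ w : Traj q, w ∈ V ↔
        ∃ x : Traj n, ∀ t, x (t + 1) = A.mulVec (x t) ∧ w t = C.mulVec (x t) := by
  have := hV.finiteDimensional
  let e := (Module.finBasis ℝ V).equivFun
  let ev : V →ₗ[ℝ] (Fin q → ℝ) := (LinearMap.proj (0 : ℤ)).comp V.subtype
  -- The state at time `t` is the trajectory shifted by `t`, in coordinates; the output reads its
  -- value at time `0`.
  let A := LinearMap.toMatrix' (e.toLinearMap ∘ₗ hV.shiftEnd ∘ₗ e.symm.toLinearMap)
  let C := LinearMap.toMatrix' (ev ∘ₗ e.symm.toLinearMap)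
  have hA : ∀ x, A.mulVec x = e (hV.shiftEnd (e.symm x)) := fun x => by
    simp [A, LinearMap.toMatrix'_mulVec]
  have hC : ∀ x, C.mulVec x = (e.symm x : Traj q) 0 := fun x => by
    simp [C, LinearMap.toMatrix'_mulVec, ev]
  refine ⟨_, A, C, ?_, fun w => ⟨fun hw => ?_, ?_⟩⟩
  · intro z hz
    obtain ⟨x, hx⟩ := hz.exists_hasEigenvector
    have hx0 := hx.2
    have hAx := hx.apply_eq_smul
    rw [Matrix.toLin'_apply] at hAx
    -- Real and imaginary parts of the eigenvector are coordinates of two real trajectories, which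
    -- together form a geometric one of ratio `z`.
    let u := fun i => (x i).re
    let v := fun i => (x i).im
    have hmul : ∀ i, (A.mulVec u i : ℂ) + A.mulVec v i * Complex.I = z * x i := by
      intro i
      rw [← smul_eq_mul z, ← Pi.smul_apply, ← hAx]
      simp only [Matrix.mulVec, dotProduct, Matrix.map_apply, Complex.ofReal_sum,
        Finset.sum_mul, ← Finset.sum_add_distrib]
      refine Finset.sum_congr rfl fun k _ => ?_
      conv_rhs => rw [← Complex.re_add_im (x k)]
      simp only [u, v, Complex.coe_algebraMap]
      push_cast
      ring
    have hu : hV.shiftEnd (e.symm u) = z.re • e.symm u - z.im • e.symm v := by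
      apply e.injective
      rw [← hA, map_sub, map_smul, map_smul, e.apply_symm_apply, e.apply_symm_apply]
      funext i
      simpa [u, v] using congrArg Complex.re (hmul i)
    have hv : hV.shiftEnd (e.symm v) = z.re • e.symm v + z.im • e.symm u := by
      apply e.injective
      rw [← hA, map_add, map_smul, map_smul, e.apply_symm_apply, e.apply_symm_apply]
      funext i
      simpa [u, v] using congrArg Complex.im (hmul i)
    have hne : ∃ s j, ((e.symm u : Traj q) s j : ℂ) + (e.symm v : Traj q) s j * Complex.I ≠ 0 := by
      by_contra! h
      have h1 : e.symm u = 0 := Subtype.ext (funext fun s => funext fun j => by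
        simpa using congrArg Complex.re (h s j))
      have h2 : e.symm v = 0 := Subtype.ext (funext fun s => funext fun j => by
        simpa using congrArg Complex.im (h s j))
      refine hx0 (funext fun i => Complex.ext ?_ ?_)
      · exact congrFun (e.symm.map_eq_zero_iff.1 h1) i
      · exact congrFun (e.symm.map_eq_zero_iff.1 h2) i
    obtain ⟨s, j, hsj⟩ := hne
    refine hV.norm_lt_one_of_geometric (e.symm u).2 (e.symm v).2 hsj fun t i => ?_
    have hut := congrFun (congrFun (congrArg Subtype.val hu) t) i
    have hvt := congrFun (congrFun (congrArg Subtype.val hv) t) i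
    rw [shiftEnd_apply] at hut hvt
    rw [hut, hvt]
    apply Complex.ext <;> simp
  · refine ⟨fun t => e ⟨shift t w, hV.shift_mem w hw t⟩, fun t => ⟨?_, ?_⟩⟩
    · rw [hA, e.symm_apply_apply]
      refine congrArg e (Subtype.ext (funext fun s => congrArg w ?_))
      ring
    · rw [hC, e.symm_apply_apply]
      simp [shift]
  · rintro ⟨x, hx⟩
    have hstep : ∀ t, e.symm (x (t + 1)) = hV.shiftEnd (e.symm (x t)) := fun t => by
      rw [(hx t).1, hA, e.symm_apply_apply]
    have hval : ∀ s t, (e.symm (x t) : Traj q) s = (e.symm (x 0) : Traj q) (s + t) := by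
      intro s t
      induction t using Int.induction_on generalizing s with
      | zero => simp
      | succ k ih =>
        rw [hstep, shiftEnd_apply, ih, add_right_comm, add_assoc]
      | pred k ih =>
        have h1 := hstep (-(k : ℤ) - 1)
        rw [sub_add_cancel] at h1
        have h2 := congrFun (congrArg Subtype.val h1) (s - 1)
        rw [shiftEnd_apply, sub_add_cancel] at h2
        rw [← h2, ih, sub_add_eq_add_sub, add_sub_assoc]
    have hw : w = (e.symm (x 0) : Traj q) := by
      funext t
      rw [(hx t).2, hC, hval, zero_add]
    rw [hw]
    exact Submodule.coe_mem _

end IsNullBehavior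

/-! ### Reduction of affine behaviors to null behaviors, and the equivalence. -/

/-- The direction of an affine behavior. -/
theorem IsAffineBehavior.exists_direction {q : ℕ} {B : Set (Traj q)} (hB : IsAffineBehavior B)
    {b : Traj q} (hb : b ∈ B) : ∃ V : Submodule ℝ (Traj q), ∀ v, v ∈ V ↔ b + v ∈ B := by
  have hsmul : ∀ (a : ℝ) (v : Traj q), b + v ∈ B → b + a • v ∈ B := fun a v hv => by
    convert hB.affine _ hv _ hb a using 1
    module
  refine ⟨{ carrier := {v | b + v ∈ B}, add_mem' := ?_, zero_mem' := ?_, smul_mem' := ?_ },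
    fun v => Iff.rfl⟩
  · intro v w hv hw
    change b + (v + w) ∈ B
    -- `b + (v + w)` is the midpoint of `b + 2v` and `b + 2w`.
    convert hB.affine _ (hsmul 2 v hv) _ (hsmul 2 w hw) (1 / 2) using 1
    module
  · change b + 0 ∈ B
    rwa [add_zero]
  · exact fun a v hv => hsmul a v hv

/-- A contractive affine behavior is a translate, by a constant trajectory, of a null behavior. -/
theorem IsAffineBehavior.exists_eq_const_add {q : ℕ} {B : Set (Traj q)}
    (hB : IsAffineBehavior B) (hc : IsContractive B) :
    ∃ (V : Submodule ℝ (Traj q)) (L : ℕ) (F : Fin q → ℝ), IsNullBehavior V L ∧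
      ∀ w, w ∈ B ↔ w - (fun _ => F) ∈ V := by
  obtain ⟨b, hb⟩ := hB.nonempty
  obtain ⟨V, hVB⟩ := hB.exists_direction hb
  obtain ⟨L, hL⟩ := hB.complete
  have hsub : ∀ w ∈ B, ∀ w' ∈ B, w - w' ∈ V := fun w hw w' hw' => by
    rw [show w - w' = (w - b) - (w' - b) by abel]
    exact V.sub_mem ((hVB _).2 (by simpa using hw)) ((hVB _).2 (by simpa using hw'))
  have hV : IsNullBehavior V L :=
    { shift_mem := fun v hv τ => by
        have := hsub _ (hB.timeInvariant _ ((hVB v).1 hv) τ) _ (hB.timeInvariant b hb τ)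
        convert this using 1
        funext t
        simp [shift]
      complete := fun w hw => by
        refine (hVB w).2 (hL _ fun t => ?_)
        obtain ⟨v, hv, hvw⟩ := hw t
        refine ⟨b + v, (hVB v).1 hv, funext fun s => ?_⟩
        simp [hvw s s.2]
      tendsto_zero := fun v hv => by
        simpa using hc _ ((hVB v).1 hv) b hb }
  -- Time-invariance puts `σ b - b` in `V`; solving `σ u - u = σ b - b` there makes `b - u`
  -- constant.
  obtain ⟨u, hu, hub⟩ := hV.exists_shift_sub (hsub _ (hB.timeInvariant b hb 1) b hb)
  have hconst : b - u = fun _ => b 0 - u 0 := by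
    have hstep : ∀ t, b (t + 1) - u (t + 1) = b t - u t := fun t => by
      have := hub t
      rw [Pi.sub_apply, shift] at this
      rw [sub_eq_sub_iff_sub_eq_sub, this]
    funext t
    rw [Pi.sub_apply]
    induction t using Int.induction_on with
    | zero => rfl
    | succ k ih => rw [hstep, ih]
    | pred k ih => rw [← ih, ← hstep (-(k : ℤ) - 1), sub_add_cancel]
  refine ⟨V, L, b 0 - u 0, hV, fun w => ?_⟩
  rw [← hconst, show w - (b - u) = (w - b) + u by abel, V.add_mem_iff_left hu, hVB,
    add_sub_cancel]

theorem isContractive_offsetKernel {q : ℕ} {R : Matrix (Fin q) (Fin q) ℝ[X]}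
    (hR : IsSchurPoly R) (c : Fin q → ℝ) : IsContractive (offsetKernel R c) :=
  fun w₁ h₁ w₂ h₂ => tendsto_zero_of_polyShift_eq_zero (w := w₁ - w₂) hR (by
    rw [polyShift_sub, show polyShift R w₁ = _ from h₁, show polyShift R w₂ = _ from h₂, sub_self])

theorem isContractive_stateSpaceBehavior {n q : ℕ} {A : Matrix (Fin n) (Fin n) ℝ}
    (hA : IsSchurMatrix A) (C : Matrix (Fin q) (Fin n) ℝ) (E : Fin n → ℝ) (F : Fin q → ℝ) :
    IsContractive (stateSpaceBehavior A C E F) := by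
  rintro w₁ ⟨x₁, h₁⟩ w₂ ⟨x₂, h₂⟩
  have hx := tendsto_zero_of_isSchurMatrix (x := x₁ - x₂) hA fun t => by
    rw [Pi.sub_apply, Pi.sub_apply, (h₁ t).1, (h₂ t).1, Matrix.mulVec_sub]
    abel
  have hcont : Continuous fun x : Fin n → ℝ => C.mulVec x := by fun_prop
  have := (hcont.tendsto 0).comp hx
  rw [Matrix.mulVec_zero] at this
  refine this.congr fun t => ?_
  simp [(h₁ t).2, (h₂ t).2, Matrix.mulVec_sub]

theorem polyShift_const {p q : ℕ} (R : Matrix (Fin p) (Fin q) ℝ[X]) (F : Fin q → ℝ) :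
    polyShift R (fun _ => F) = fun _ => polyShift R (fun _ => F) 0 := by
  funext t i
  rw [polyShift_apply, polyShift_apply, ← zero_add t, ← rowShift_shift]
  rfl

end AffineBehavior

theorem corollary1 (q : ℕ) (B : Set (AffineBehavior.Traj q))
    (hB : AffineBehavior.IsAffineBehavior B) :
    List.TFAE [
      AffineBehavior.IsContractive B,
      ∃ (c : Fin q → ℝ) (R : Matrix (Fin q) (Fin q) ℝ[X]),
        AffineBehavior.IsSchurPoly R ∧ B = AffineBehavior.offsetKernel R c,
      ∃ (n : ℕ) (A : Matrix (Fin n) (Fin n) ℝ) (C : Matrix (Fin q) (Fin n) ℝ)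
        (E : Fin n → ℝ) (F : Fin q → ℝ),
        AffineBehavior.IsSchurMatrix A ∧ B = AffineBehavior.stateSpaceBehavior A C E F] := by
  tfae_have 1 → 2 := by
    intro hc
    obtain ⟨V, L, F, hV, hVB⟩ := hB.exists_eq_const_add hc
    obtain ⟨R, hR⟩ := hV.exists_kernel
    -- The offset is `R(σ)` applied to the constant `F`, that is `R(1) F`.
    refine ⟨AffineBehavior.polyShift R (fun _ => F) 0, R,
      hV.isSchurPoly_of_kernel fun w => (hR w).1, Set.ext fun w => ?_⟩
    rw [hVB, ← hR, AffineBehavior.polyShift_sub, sub_eq_zero, AffineBehavior.polyShift_const]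
    rfl
  tfae_have 1 → 3 := by
    intro hc
    obtain ⟨V, L, F, hV, hVB⟩ := hB.exists_eq_const_add hc
    obtain ⟨n, A, C, hA, hAC⟩ := hV.exists_stateSpace
    refine ⟨n, A, C, 0, F, hA, Set.ext fun w => ?_⟩
    rw [hVB, hAC]
    simp [AffineBehavior.stateSpaceBehavior, sub_eq_iff_eq_add]
  tfae_have 2 → 1 := by
    rintro ⟨c, R, hR, rfl⟩
    exact AffineBehavior.isContractive_offsetKernel hR c
  tfae_have 3 → 1 := by
    rintro ⟨n, A, C, E, F, hA, rfl⟩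
    exact AffineBehavior.isContractive_stateSpaceBehavior hA C E F
  tfae_finish
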